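/- **Quantized modulo ADC, $b$-bit.** Let $\lambda,B,f_s>0$, $T=1/f_s$, $\Omega=2\pi B$, and let $g\in\mathrm{PW}_\Omega$ be a real, continuous, finite-energy signal whose Fourier transform vanishes (a.e.) outside $[-\Omega,\Omega]$. Let $\beta_g$ be any number with $|g(t)|\le\beta_g$ for all $t$. Put $$\rho=\frac{\|g\|_\infty}{\lambda},\qquad \mathrm{OF}=\frac{f_s}{2B},\qquad \gamma[k]=g(kT),\qquad y[k]=\mathcal M_\lambda(\gamma[k])\quad(k\in\mathbb Z),$$ where $\mathcal M_\lambda(x)=x-2\lambda\lfloor (x+\lambda)/(2\lambda)\rfloor\in[-\lambda,\lambda)$. Let $b\ge 0$ be an integer, $q=2\lambda/2^{b}$, and let $Q(x)=-\lambda+q\left(\lfloor (x+\lambda)/q\rfloor+\tfrac12\right)$ be the uniform $b$-bit quantizer of $[-\lambda,\lambda)$. The measured samples are $y_\eta[k]=Q(y[k])=y[k]+\eta[k]$, with quantization error $\eta[k]=Q(y[k])-y[k]$. 1. The sequence $\eta$ is bounded and $\rho_\eta:=\|\eta\|_\infty/\lambda\le 2^{-b}$. 2. For every integer $N$ with $1\le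 N<b$ such that $$\mathrm{OF}>\pi\left(\frac{\rho}{1-2^{N-b}}\right)^{1/N},$$ the recovery algorithm of order $N$ below, run on $y_\eta$, $\lambda$, $\beta_g$, recovers the samples up to the quantization error and a global multiple of $2\lambda$: whatever integer $m$ is used in its last step, there is $m'\in\mathbb Z$ such that $$\tilde\gamma[k]=\gamma[k]+\eta[k]+2m'\lambda\qquad\text{for all }k\in\mathbb Z .$$ *Algorithm of order $N$.* Write $(\Delta x)[k]=x[k+1]-x[k]$ and let $\mathrm S$ be the anti-difference, $(\mathrm Sx)[k]=\sum_{m=1}^{k-1}x[m]$ for $k\ge1$ and $(\mathrm Sx)[k]=-\sum_{m=k}^{0}x[m]$ for $k\le 0$. Set $s_{(0)}=\mathcal M_\lambda(\Delta^N y_\eta)-\Delta^N y_\eta$ and $J=\left\lceil 4\left(\beta_g/\lambda+2^{N-2}\right)\right\rceil$. For $n=0,\dots,N-2$ put $$\kappa_n=\left\lfloor\frac{(\mathrm S^2s_{(n)})[1]-(\mathrm S^2s_{(n)})[J+1]}{2J\lambda}+\frac12\right\rfloor,\qquad s_{(n+1)}[k]=2\lambda\left\lfloor\frac{(\mathrm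 Ss_{(n)})[k]}{2\lambda}\right\rceil+2\lambda\kappa_n ,$$ where $\lfloor\cdot\rceil$ is rounding to the nearest integer (halves rounded up). Output $\tilde\gamma[k]=(\mathrm Ss_{(N-1)})[k]+y_\eta[k]+2m\lambda$, with an arbitrary $m\in\mathbb Z$. -/

import Mathlib

open MeasureTheory FourierTransform

namespace ModuloADC

noncomputable section

/-- The supremum norm of a real function or sequence (meaningful when it is bounded). -/
def supNorm {α : Type*} (f : α → ℝ) : ℝ := ⨆ t, |f t|

/-- Real signals in the Paley-Wiener space of finite-energy signals bandlimited to `[-Ω, Ω]`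
(in rad/s), represented by their continuous version so that point samples make sense.
The `L²` Fourier transform of Mathlib uses the ordinary frequency `ξ`, i.e. `ω = 2 π ξ`. -/
def IsPaleyWiener (Ω : ℝ) (g : ℝ → ℝ) : Prop :=
  Continuous g ∧
    ∃ hg : MemLp (fun t : ℝ => (g t : ℂ)) 2 (volume : Measure ℝ),
      ∀ᵐ ξ : ℝ ∂volume, Ω < |2 * Real.pi * ξ| → (𝓕 (hg.toLp) : Lp ℂ 2 volume) ξ = 0

/-- The centered modulo operation, with values in `[-lam, lam)`. -/
def modFold (lam x : ℝ) : ℝ := x - 2 * lam * ⌊(x + lam) / (2 * lam)⌋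

/-- Uniform samples `γ[k] = g (k T)`. -/
def samples (g : ℝ → ℝ) (T : ℝ) (k : ℤ) : ℝ := g (k * T)

/-- Modulo samples `y[k]`. -/
def moduloSamples (lam : ℝ) (g : ℝ → ℝ) (T : ℝ) (k : ℤ) : ℝ := modFold lam (samples g T k)

/-- Quantization step of a `b`-bit quantizer of `[-lam, lam)`. -/
def quantStep (lam : ℝ) (b : ℕ) : ℝ := 2 * lam / 2 ^ b

/-- The uniform `b`-bit quantizer of `[-lam, lam)`: the interval is cut into `2 ^ b` cells
`[-lam + j q, -lam + (j + 1) q)` and every point is sent to the midpoint of its cell. -/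
def quantize (lam : ℝ) (b : ℕ) (x : ℝ) : ℝ :=
  -lam + quantStep lam b * (⌊(x + lam) / quantStep lam b⌋ + 1 / 2)

/-- Quantized modulo samples: the data handed to the recovery algorithm. -/
def quantizedSamples (lam : ℝ) (b : ℕ) (g : ℝ → ℝ) (T : ℝ) (k : ℤ) : ℝ :=
  quantize lam b (moduloSamples lam g T k)

/-- The quantization error `η[k]`, so that quantized samples are `y[k] + η[k]`. -/
def quantError (lam : ℝ) (b : ℕ) (g : ℝ → ℝ) (T : ℝ) (k : ℤ) : ℝ :=
  quantizedSamples lam b g T k - moduloSamples lam g T k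

/-- The anti-difference of `x`, normalized to vanish at `k = 1`: it is `∑_{1 ≤ m < k} x[m]` for
`k ≥ 1`, and it is continued to `k ≤ 0` (as `-∑_{k ≤ m < 1} x[m]`) so that `Δ (S x) = x` on `ℤ`. -/
def antiDiff (x : ℤ → ℝ) (k : ℤ) : ℝ :=
  ∑ m ∈ Finset.Ico 1 k, x m - ∑ m ∈ Finset.Ico k 1, x m

/-- Block length `J`; the exponent is an integer, possibly negative. -/
def blockLength (N : ℕ) (lam βg : ℝ) : ℤ :=
  ⌈4 * (βg / lam + (2 : ℝ) ^ ((N : ℤ) - 2))⌉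

/-- The integer `κ` computed from the current sequence `s`. -/
def kappa (J : ℤ) (lam : ℝ) (s : ℤ → ℝ) : ℤ :=
  ⌊(antiDiff (antiDiff s) 1 - antiDiff (antiDiff s) (J + 1)) / (2 * J * lam) + 1 / 2⌋

/-- One pass of the loop: anti-difference, round to `2 lam ℤ`, and shift by `2 lam κ`. -/
def loopStep (J : ℤ) (lam : ℝ) (s : ℤ → ℝ) (k : ℤ) : ℝ :=
  2 * lam * round (antiDiff s k / lam / 2) + 2 * lam * kappa J lam s

/-- The initial sequence `M(Δ^N y) - Δ^N y` computed from the measured data `y`. -/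
def initialSeq (N : ℕ) (lam : ℝ) (y : ℤ → ℝ) (k : ℤ) : ℝ :=
  modFold lam (((fwdDiff (1 : ℤ))^[N] y) k) - ((fwdDiff (1 : ℤ))^[N] y) k

/-- Unfolded samples returned by the fixed-order difference recovery algorithm of order `N`,
run on the data `y` with threshold `lam` and amplitude bound `βg`; `m` is the integer that the
algorithm leaves free in its last line. The loop is passed `N - 1` times. -/
def recover (N : ℕ) (lam βg : ℝ) (m : ℤ) (y : ℤ → ℝ) (k : ℤ) : ℝ :=
  antiDiff ((loopStep (blockLength N lam βg) lam)^[N - 1] (initialSeq N lam y)) k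
    + y k + 2 * m * lam

/-- Amplitude scaling factor `ρ`. -/
def ampFactor (lam : ℝ) (g : ℝ → ℝ) : ℝ := supNorm g / lam

/-- Normalized noise level `ρ_η`. -/
def noiseLevel (lam : ℝ) (η : ℤ → ℝ) : ℝ := supNorm η / lam

/-- Oversampling factor relative to the Nyquist rate. -/
def overFactor (fs B : ℝ) : ℝ := fs / (2 * B)

end

end ModuloADC

/-!
M. Riesz' interpolation formula writes the derivative of a signal bandlimited to `[-B, B]` as a
combination of its translates, with the Fourier coefficients of a triangle wave: on `[-B, B]` the
multiplier `ξ` of the derivative agrees with such a wave. The coefficients have `ℓ¹` norm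
`2 * π * B`, which is Bernstein's inequality, and hence `|Δ ^ N γ| ≤ (Ω * T) ^ N * ‖g‖`. The rate
condition guarantees that this plus the noise contribution `2 ^ N * ‖η‖` stays below `lam`, so that
folding `Δ ^ N y_η` gives `Δ ^ N (γ + η)` and the initial sequence is `Δ ^ N w`, where `w = γ - y`
has values in `2 * lam * ℤ`. Each anti-difference then recovers a lower difference of `w` up to a
constant in `2 * lam * ℤ`. A wrong constant would add a linear trend of slope at least `2 * lam` to
the next anti-difference, while the lower differences of `w` vary by less than `J * lam` over `J`
steps: this is how `κ` identifies the constant.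
-/

section ForwardDifference

variable {M M' G G' : Type*} [AddCommMonoid M] [AddCommMonoid M'] [AddCommGroup G]
  [AddCommGroup G']

theorem fwdDiff_iter_addMonoidHom_comp (φ : G →+ G') (h : M) (f : M → G) (n : ℕ) :
    (fwdDiff h)^[n] (φ ∘ f) = φ ∘ (fwdDiff h)^[n] f := by
  have h_semiconj : Function.Semiconj (φ ∘ ·) (fwdDiff h : (M → G) → M → G) (fwdDiff h) :=
    fun f ↦ by ext; simp [fwdDiff]
  exact (h_semiconj.iterate_right n f).symm

theorem fwdDiff_iter_comp_addMonoidHom (ψ : M →+ M') (h : M) (f : M' → G) (n : ℕ) :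
    (fwdDiff h)^[n] (f ∘ ψ) = (fwdDiff (ψ h))^[n] f ∘ ψ := by
  have h_semiconj : Function.Semiconj (· ∘ ψ) (fwdDiff (ψ h) : (M' → G) → M' → G) (fwdDiff h) :=
    fun f ↦ by ext; simp [fwdDiff]
  exact (h_semiconj.iterate_right n f).symm

theorem fwdDiff_iter_sub (h : M) (f g : M → G) (n : ℕ) :
    (fwdDiff h)^[n] (f - g) = (fwdDiff h)^[n] f - (fwdDiff h)^[n] g := by
  simpa only [fwdDiff_aux.coe_fwdDiffₗ_pow] using map_sub (fwdDiff_aux.fwdDiffₗ M G h ^ n) f g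

theorem fwdDiff_iter_mem (S : AddSubgroup G) {f : M → G} (hf : ∀ x, f x ∈ S) (h : M) (n : ℕ)
    (x : M) : (fwdDiff h)^[n] f x ∈ S := by
  induction n generalizing x with
  | zero => exact hf x
  | succ n ih =>
    rw [Function.iterate_succ_apply']
    exact S.sub_mem (ih _) (ih _)

theorem norm_fwdDiff_iter_le {E : Type*} [SeminormedAddCommGroup E] {f : M → E} {C : ℝ}
    (hf : ∀ x, ‖f x‖ ≤ C) (h : M) (n : ℕ) (x : M) : ‖(fwdDiff h)^[n] f x‖ ≤ 2 ^ n * C := by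
  induction n generalizing x with
  | zero => simpa using hf x
  | succ n ih =>
    rw [Function.iterate_succ_apply', pow_succ', mul_assoc, two_mul]
    exact norm_sub_le_of_le (ih _) (ih _)

end ForwardDifference

section Fourier

open RealInnerProductSpace

variable {V E : Type*} [NormedAddCommGroup V] [InnerProductSpace ℝ V] [FiniteDimensional ℝ V]
  [MeasurableSpace V] [BorelSpace V] [NormedAddCommGroup E] [NormedSpace ℂ E]

theorem continuous_fourierInv_of_integrable {f : V → E} (hf : Integrable f) :
    Continuous (𝓕⁻ f) := by
  rw [Real.fourierInv_eq_fourier_comp_neg]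
  exact VectorFourier.fourierIntegral_continuous Real.continuous_fourierChar
    continuous_inner hf.comp_neg

theorem integral_fourierInv_smul_eq [CompleteSpace E] {f : V → ℂ} {g : V → E} (hf : Integrable f)
    (hg : Integrable g) : ∫ x, 𝓕⁻ f x • g x = ∫ x, f x • 𝓕⁻ g x := by
  have h_flip : (-(innerₗ V)).flip = -innerₗ V := by ext; simp [real_inner_comm]
  have h_cont : Continuous fun p : V × V ↦ (-(innerₗ V)) p.1 p.2 := by
    simpa using! continuous_inner.neg
  have h := VectorFourier.integral_fourierIntegral_smul_eq_flip (μ := volume) (ν := volume)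
    Real.continuous_fourierChar h_cont hf hg
  rwa [h_flip] at h

theorem coeFn_fourierInv_ae_eq {H : Type*} [NormedAddCommGroup H] [InnerProductSpace ℂ H]
    [CompleteSpace H] (F : Lp H 2 (volume : Measure V)) (hF : Integrable F) :
    (𝓕⁻ F : Lp H 2 (volume : Measure V)) =ᵐ[volume] 𝓕⁻ (F : V → H) := by
  have h_loc : LocallyIntegrable (𝓕⁻ F : Lp H 2 (volume : Measure V)) :=
    (Lp.memLp _).locallyIntegrable one_le_two
  refine ae_eq_of_integral_contDiff_smul_eq h_loc
    (continuous_fourierInv_of_integrable hF).locallyIntegrable fun φ hφ_smooth hφ_supp ↦ ?_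
  have hφ_supp' : HasCompactSupport (Complex.ofRealCLM ∘ φ) := hφ_supp.comp_left rfl
  let ψ : SchwartzMap V ℂ := hφ_supp'.toSchwartzMap (Complex.ofRealCLM.contDiff.comp hφ_smooth)
  have h_temp := DFunLike.congr_fun (Lp.fourierInv_toTemperedDistribution_eq F) ψ
  simp only [TemperedDistribution.fourierInv_apply, Lp.toTemperedDistribution_apply,
    SchwartzMap.fourierInv_coe, integral_fourierInv_smul_eq ψ.integrable hF] at h_temp
  calc ∫ x, φ x • (𝓕⁻ F : Lp H 2 (volume : Measure V)) x
      = ∫ x, ψ x • (𝓕⁻ F : Lp H 2 (volume : Measure V)) x := rfl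
    _ = ∫ x, ψ x • 𝓕⁻ (F : V → H) x := h_temp.symm
    _ = ∫ x, φ x • 𝓕⁻ (F : V → H) x := rfl

theorem hasSum_smul_fourier_add {ι : Type*} [Countable ι] {a : ι → ℂ} {s : ι → V} {m : V → ℂ}
    {f : V → E} (hf : Integrable f) (ha : Summable a)
    (hm : ∀ᵐ ξ, f ξ ≠ 0 → HasSum (fun n ↦ a n * 𝐞 (-⟪ξ, s n⟫)) (m ξ)) (t : V) :
    HasSum (fun n ↦ a n • 𝓕 f (t + s n)) (𝓕 (fun ξ ↦ m ξ • f ξ) t) := by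
  have h_int (n : ι) : Integrable fun ξ ↦ a n • 𝐞 (-⟪ξ, t + s n⟫) • f ξ :=
    ((Real.fourierIntegral_convergent_iff _).2 hf).smul (a n)
  have h_summable : Summable fun n ↦ ∫ ξ, ‖a n • 𝐞 (-⟪ξ, t + s n⟫) • f ξ‖ := by
    simp only [norm_smul, Circle.norm_smul, integral_const_mul]
    exact ha.norm.mul_right _
  have h_tsum : (fun ξ ↦ ∑' n, a n • 𝐞 (-⟪ξ, t + s n⟫) • f ξ) =ᵐ[volume]
      fun ξ ↦ 𝐞 (-⟪ξ, t⟫) • m ξ • f ξ := by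
    filter_upwards [hm] with ξ hξ
    rcases eq_or_ne (f ξ) 0 with h0 | h0
    · simp [h0]
    refine HasSum.tsum_eq ?_
    convert ((hξ h0).smul_const (f ξ)).const_smul (𝐞 (-⟪ξ, t⟫)) using 2 with n
    simp only [inner_add_right, neg_add, AddChar.map_add_eq_mul, Circle.smul_def, Circle.coe_mul,
      smul_smul]
    ring_nf
  have h := hasSum_integral_of_summable_integral_norm h_int h_summable
  simpa only [integral_smul, integral_congr_ae h_tsum, ← Real.fourier_eq] using h

/-- The functions bandlimited to the ball of radius `B`, encoded as the Fourier transforms of the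
integrable functions that vanish off this ball, a class stable under translation and containing the
continuous finite-energy signals with such a spectrum. Using `𝓕` in place of `𝓕⁻` only reflects the
spectrum; frequencies are ordinary, not angular. -/
def IsBandlimited (B : ℝ) (F : V → E) : Prop :=
  ∃ f : V → E, Integrable f ∧ (∀ᵐ ξ, B < ‖ξ‖ → f ξ = 0) ∧ 𝓕 f = F

theorem isBandlimited_fwdDiff {B : ℝ} {F : V → E} (hF : IsBandlimited B F) (h : V) :
    IsBandlimited B (fwdDiff h F) := by
  obtain ⟨f, hf, hf_supp, rfl⟩ := hF
  have h_int : Integrable fun ξ ↦ 𝐞 (-⟪ξ, h⟫) • f ξ :=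
    (Real.fourierIntegral_convergent_iff h).2 hf
  refine ⟨fun ξ ↦ 𝐞 (-⟪ξ, h⟫) • f ξ - f ξ, h_int.sub hf, ?_, ?_⟩
  · filter_upwards [hf_supp] with ξ hξ hBξ
    simp [hξ hBξ]
  · ext t
    simp only [fwdDiff, Real.fourier_eq, smul_sub]
    rw [integral_sub ((Real.fourierIntegral_convergent_iff t).2 h_int)
      ((Real.fourierIntegral_convergent_iff t).2 hf)]
    simp only [smul_smul, inner_add_right, neg_add, AddChar.map_add_eq_mul]

theorem isBandlimited_of_fourier_toLp_ae_eq_zero {H : Type*} [NormedAddCommGroup H]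
    [InnerProductSpace ℂ H] [CompleteSpace H] {B : ℝ} {G : V → H} (hG : Continuous G)
    (hG2 : MemLp G 2)
    (h_supp : ∀ᵐ ξ, B < ‖ξ‖ → (𝓕 hG2.toLp : Lp H 2 (volume : Measure V)) ξ = 0) :
    IsBandlimited B G := by
  set F : Lp H 2 (volume : Measure V) := 𝓕 hG2.toLp
  have hF : Integrable F := by
    have h_ball : IntegrableOn F (Metric.closedBall 0 B) := by
      have : Fact (volume (Metric.closedBall (0 : V) B) < ⊤) := ⟨measure_closedBall_lt_top⟩
      exact ((Lp.memLp F).restrict _).integrable one_le_two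
    refine h_ball.integrable_of_ae_notMem_eq_zero ?_
    filter_upwards [h_supp] with ξ hξ h_notMem
    exact hξ (by simpa using h_notMem)
  have h_inv : 𝓕⁻ (F : V → H) = G := by
    refine ((continuous_fourierInv_of_integrable hF).ae_eq_iff_eq volume hG).1 ?_
    filter_upwards [coeFn_fourierInv_ae_eq F hF, hG2.coeFn_toLp] with t ht hGt
    rw [← ht, fourierInv_fourier_eq, hGt]
  refine ⟨fun ξ ↦ F (-ξ), hF.comp_neg, ?_, ?_⟩
  · have h_neg := Measure.measurePreserving_neg (volume : Measure V)
    filter_upwards [h_neg.quasiMeasurePreserving.ae h_supp] with ξ hξ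
    simpa using hξ
  · rw [← Real.fourierInv_eq_fourier_comp_neg, h_inv]

end Fourier

section TriangleWave

open scoped Real
open Complex (I)

/-- The Fourier coefficients `1 / n ^ 2` (`n` odd), `0` (`n` even) of a triangle wave. -/
noncomputable def oddInvSq (n : ℤ) : ℝ := if Odd n then 1 / (n : ℝ) ^ 2 else 0

theorem fourierChar_int_mul_add_half (n : ℤ) (x : ℝ) :
    (𝐞 (n * (x + 1 / 2)) : ℂ) = (-1) ^ n * 𝐞 (n * x) := by
  rw [mul_add, AddChar.map_add_eq_mul, Circle.coe_mul, mul_comm]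
  congr 1
  rw [Real.fourierChar_apply, ← Complex.exp_pi_mul_I, ← Complex.exp_int_mul]
  push_cast
  ring_nf

theorem hasSum_one_div_sq_mul_fourierChar {x : ℝ} (hx : x ∈ Set.Icc (0 : ℝ) 1) :
    HasSum (fun n : ℤ ↦ 1 / (n : ℂ) ^ 2 * 𝐞 (n * x))
      ((2 * π ^ 2 * (x ^ 2 - x + 6⁻¹) : ℝ) : ℂ) := by
  convert hasSum_one_div_pow_mul_fourier_mul_bernoulliFun le_rfl hx using 1
  · ext n
    rw [fourier_coe_apply, Real.fourierChar_apply]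
    push_cast
    ring_nf
  · rw [bernoulliFun_two, mul_pow, Complex.I_sq]
    push_cast
    ring

theorem hasSum_oddInvSq_mul_fourierChar {x : ℝ} (hx : x ∈ Set.Icc (0 : ℝ) (1 / 2)) :
    HasSum (fun n ↦ oddInvSq n * (𝐞 (n * x) : ℂ)) ((π ^ 2 * (1 / 4 - x) : ℝ) : ℂ) := by
  have h_x := hasSum_one_div_sq_mul_fourierChar ⟨hx.1, hx.2.trans (by norm_num)⟩
  have h_shift := hasSum_one_div_sq_mul_fourierChar (x := x + 1 / 2)
    ⟨by linarith [hx.1], by linarith [hx.2]⟩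
  -- The shift by half a period changes the sign of the odd terms only.
  have h_terms : (fun n ↦ oddInvSq n * (𝐞 (n * x) : ℂ)) = fun n : ℤ ↦
      1 / 2 * (1 / (n : ℂ) ^ 2 * 𝐞 (n * x) - 1 / (n : ℂ) ^ 2 * 𝐞 (n * (x + 1 / 2))) := by
    ext n
    rw [fourierChar_int_mul_add_half]
    rcases n.even_or_odd with hn | hn
    · simp [oddInvSq, hn.neg_one_zpow, Int.not_odd_iff_even.2 hn]
    · simp only [oddInvSq, hn, hn.neg_one_zpow, if_true]
      push_cast
      ring
  have h_value : ((π ^ 2 * (1 / 4 - x) : ℝ) : ℂ) =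
      1 / 2 * (((2 * π ^ 2 * (x ^ 2 - x + 6⁻¹) : ℝ) : ℂ) -
        (2 * π ^ 2 * ((x + 1 / 2) ^ 2 - (x + 1 / 2) + 6⁻¹) : ℝ)) := by
    push_cast
    ring
  rw [h_terms, h_value]
  exact (h_x.sub h_shift).mul_left (1 / 2)

theorem hasSum_oddInvSq : HasSum oddInvSq (π ^ 2 / 4) := by
  have h := hasSum_oddInvSq_mul_fourierChar (x := 0) ⟨le_rfl, by norm_num⟩
  simpa [← Complex.ofReal_mul, Complex.hasSum_ofReal, div_eq_mul_inv] using h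

theorem hasSum_oddInvSq_mul_I_zpow {B ξ : ℝ} (hB : 0 < B) (hξ : |ξ| ≤ B) :
    HasSum (fun n ↦ oddInvSq n * I ^ n * (𝐞 (-(n / (4 * B) * ξ)) : ℂ))
      ((π ^ 2 * ξ / (4 * B) : ℝ) : ℂ) := by
  have h_mem : ξ / (4 * B) ∈ Set.Icc (-(1 / 4) : ℝ) (1 / 4) := by
    rw [Set.mem_Icc, ← abs_le, abs_div, abs_of_pos (by positivity : 0 < 4 * B),
      div_le_iff₀ (by positivity)]
    linarith
  convert hasSum_oddInvSq_mul_fourierChar (x := 1 / 4 - ξ / (4 * B))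
    ⟨by linarith [h_mem.2], by linarith [h_mem.1]⟩ using 1
  · ext n
    have h_I : (𝐞 (n * (1 / 4)) : ℂ) = I ^ n := by
      conv_rhs => rw [← Complex.exp_pi_div_two_mul_I, ← Complex.exp_int_mul]
      rw [Real.fourierChar_apply]
      congr 1
      push_cast
      ring
    rw [mul_sub, sub_eq_add_neg, AddChar.map_add_eq_mul, Circle.coe_mul, h_I, mul_assoc]
    ring_nf
  · congr 1
    ring

/-- The coefficients of M. Riesz' interpolation formula for the derivative of a signal bandlimited
to `[-B, B]`, with nodes at the multiples of `1 / (4 * B)`. -/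
noncomputable def rieszCoeff (B : ℝ) (n : ℤ) : ℂ := -(8 * B / π) * I * (oddInvSq n * I ^ n)

theorem norm_rieszCoeff {B : ℝ} (hB : 0 ≤ B) (n : ℤ) :
    ‖rieszCoeff B n‖ = 8 * B / π * oddInvSq n := by
  have h_nonneg : 0 ≤ oddInvSq n := by
    unfold oddInvSq
    positivity
  simp [rieszCoeff, norm_zpow, abs_of_nonneg hB, abs_of_pos Real.pi_pos, abs_of_nonneg h_nonneg]

theorem hasSum_norm_rieszCoeff {B : ℝ} (hB : 0 ≤ B) :
    HasSum (fun n ↦ ‖rieszCoeff B n‖) (2 * π * B) := by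
  have h_value : 2 * π * B = 8 * B / π * (π ^ 2 / 4) := by
    field_simp
    ring
  rw [h_value, funext (norm_rieszCoeff hB)]
  exact hasSum_oddInvSq.mul_left (8 * B / π)

theorem hasSum_rieszCoeff_mul_fourierChar {B ξ : ℝ} (hB : 0 < B) (hξ : |ξ| ≤ B) :
    HasSum (fun n ↦ rieszCoeff B n * (𝐞 (-(n / (4 * B) * ξ)) : ℂ)) (-2 * π * I * ξ) := by
  have h_terms : (fun n : ℤ ↦ rieszCoeff B n * (𝐞 (-(n / (4 * B) * ξ)) : ℂ)) = fun n : ℤ ↦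
      -(8 * B / π) * I * (oddInvSq n * I ^ n * (𝐞 (-(n / (4 * B) * ξ)) : ℂ)) := by
    ext n
    rw [rieszCoeff, mul_assoc]
  have h_value : -2 * π * I * ξ = -(8 * B / π) * I * ((π ^ 2 * ξ / (4 * B) : ℝ) : ℂ) := by
    have hB' : (B : ℂ) ≠ 0 := by exact_mod_cast hB.ne'
    push_cast
    field_simp
    ring
  rw [h_terms, h_value]
  exact (hasSum_oddInvSq_mul_I_zpow hB hξ).mul_left _

end TriangleWave

section Bernstein

open scoped Real

theorem integrable_smul_of_ae_eq_zero {E : Type*} [NormedAddCommGroup E] [NormedSpace ℝ E]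
    {B : ℝ} {f : ℝ → E} (hf : Integrable f) (hf_supp : ∀ᵐ ξ, B < ‖ξ‖ → f ξ = 0) :
    Integrable fun ξ ↦ ξ • f ξ := by
  refine (hf.norm.const_mul B).mono' (aestronglyMeasurable_id.smul hf.aestronglyMeasurable) ?_
  filter_upwards [hf_supp] with ξ hξ
  rw [norm_smul]
  rcases le_or_gt ‖ξ‖ B with h | h
  · gcongr
  · simp [hξ h]

namespace IsBandlimited

variable {E : Type*} [NormedAddCommGroup E] [NormedSpace ℂ E] {B : ℝ} {F : ℝ → E}

theorem differentiable (hF : IsBandlimited B F) : Differentiable ℝ F := by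
  obtain ⟨f, hf, hf_supp, rfl⟩ := hF
  have h_int := integrable_smul_of_ae_eq_zero hf hf_supp
  exact fun t ↦ (Real.hasDerivAt_fourier hf h_int t).differentiableAt

theorem hasSum_rieszCoeff_smul (hB : 0 < B) (hF : IsBandlimited B F) (t : ℝ) :
    HasSum (fun n ↦ rieszCoeff B n • F (t + n / (4 * B))) (deriv F t) := by
  obtain ⟨f, hf, hf_supp, rfl⟩ := hF
  rw [Real.deriv_fourier hf (integrable_smul_of_ae_eq_zero hf hf_supp)]
  refine hasSum_smul_fourier_add hf (hasSum_norm_rieszCoeff hB.le).summable.of_norm ?_ t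
  filter_upwards [hf_supp] with ξ hξ hfξ
  exact hasSum_rieszCoeff_mul_fourierChar hB (not_lt.1 (mt hξ hfξ))

theorem norm_deriv_le (hB : 0 < B) (hF : IsBandlimited B F) {M : ℝ}
    (hM : ∀ t, ‖F t‖ ≤ M) (t : ℝ) : ‖deriv F t‖ ≤ 2 * π * B * M := by
  have h_terms (n : ℤ) : ‖rieszCoeff B n • F (t + n / (4 * B))‖ ≤ ‖rieszCoeff B n‖ * M := by
    rw [norm_smul]
    gcongr
    exact hM _
  rw [← (hF.hasSum_rieszCoeff_smul hB t).tsum_eq]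
  exact tsum_of_norm_bounded ((hasSum_norm_rieszCoeff hB.le).mul_right M) h_terms

theorem norm_fwdDiff_le (hB : 0 < B) (hF : IsBandlimited B F) {M : ℝ}
    (hM : ∀ t, ‖F t‖ ≤ M) (T t : ℝ) : ‖fwdDiff T F t‖ ≤ 2 * π * B * |T| * M := by
  have h := convex_univ.norm_image_sub_le_of_norm_deriv_le
    (fun s _ ↦ hF.differentiable s) (fun s _ ↦ hF.norm_deriv_le hB hM s)
    (Set.mem_univ t) (Set.mem_univ (t + T))
  rw [add_sub_cancel_left, Real.norm_eq_abs] at h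
  exact h.trans_eq (by ring)

theorem norm_fwdDiff_iter_le (hB : 0 < B) (hF : IsBandlimited B F) {M : ℝ}
    (hM : ∀ t, ‖F t‖ ≤ M) (T : ℝ) (n : ℕ) (t : ℝ) :
    ‖(fwdDiff T)^[n] F t‖ ≤ (2 * π * B * |T|) ^ n * M := by
  induction n generalizing F M with
  | zero => simpa using hM t
  | succ n ih =>
    rw [Function.iterate_succ_apply, pow_succ, mul_assoc]
    exact ih (isBandlimited_fwdDiff hF T) (hF.norm_fwdDiff_le hB hM T)

end IsBandlimited

end Bernstein

namespace ModuloADC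

open Set
open scoped Real

section Folding

variable {lam x y : ℝ}

theorem modFold_eq_toIcoMod (hlam : 0 < lam) (x : ℝ) :
    modFold lam x = toIcoMod (mul_pos two_pos hlam) (-lam) x := by
  rw [modFold, toIcoMod, toIcoDiv_eq_floor, sub_neg_eq_add, zsmul_eq_mul, mul_comm]

theorem modFold_eq_iff (hlam : 0 < lam) :
    modFold lam x = y ↔ y ∈ Ico (-lam) lam ∧ x - y ∈ AddSubgroup.zmultiples (2 * lam) := by
  rw [modFold_eq_toIcoMod hlam, toIcoMod_eq_iff, AddSubgroup.mem_zmultiples_iff,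
    show -lam + 2 * lam = lam by ring]
  simp only [eq_comm, sub_eq_iff_eq_add']

theorem abs_modFold_le (hlam : 0 < lam) (x : ℝ) : |modFold lam x| ≤ lam :=
  have h_mem := ((modFold_eq_iff hlam (x := x)).1 rfl).1
  abs_le.2 ⟨h_mem.1, h_mem.2.le⟩

theorem modFold_sub_of_mem_zmultiples (hx : |x| < lam)
    (hy : y ∈ AddSubgroup.zmultiples (2 * lam)) : modFold lam (x - y) = x :=
  (modFold_eq_iff ((abs_nonneg x).trans_lt hx)).2
    ⟨⟨(abs_lt.1 hx).1.le, (abs_lt.1 hx).2⟩, by simpa using hy⟩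

theorem modFold_eq_self (hx : |x| < lam) : modFold lam x = x := by
  simpa using modFold_sub_of_mem_zmultiples hx (zero_mem _)

theorem abs_quantize_sub_le (hlam : 0 < lam) (b : ℕ) (x : ℝ) :
    |quantize lam b x - x| ≤ lam * (2 : ℝ) ^ (-(b : ℤ)) := by
  have hq : 0 < quantStep lam b := by
    unfold quantStep
    positivity
  have h_floor_le := Int.floor_le ((x + lam) / quantStep lam b)
  have h_lt_floor := Int.lt_floor_add_one ((x + lam) / quantStep lam b)
  rw [le_div_iff₀ hq] at h_floor_le
  rw [div_lt_iff₀ hq] at h_lt_floor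
  have h_half_step : lam * (2 : ℝ) ^ (-(b : ℤ)) = quantStep lam b / 2 := by
    rw [quantStep, zpow_neg, zpow_natCast]
    ring
  rw [h_half_step, quantize, abs_le]
  constructor <;> linarith

end Folding

section Algorithm

theorem antiDiff_one (x : ℤ → ℝ) : antiDiff x 1 = 0 := by simp [antiDiff]

theorem antiDiff_add_one (x : ℤ → ℝ) (k : ℤ) : antiDiff x (k + 1) = antiDiff x k + x k := by
  unfold antiDiff
  rcases le_or_gt 1 k with h | h
  · rw [← Finset.insert_Ico_right_eq_Ico_add_one h, Finset.sum_insert (by simp),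
      Finset.Ico_eq_empty (a := k + 1) (by lia), Finset.Ico_eq_empty (a := k) (by lia)]
    ring
  · rw [← Finset.insert_Ico_add_one_left_eq_Ico h, Finset.sum_insert (by simp),
      Finset.Ico_eq_empty (b := k + 1) (by lia), Finset.Ico_eq_empty (b := k) (by lia)]
    ring

theorem antiDiff_fwdDiff (w : ℤ → ℝ) : antiDiff (fwdDiff 1 w) = fun k ↦ w k - w 1 := by
  ext k
  induction k using Int.inductionOn' (b := 1) with
  | zero => simp [antiDiff_one]
  | succ k _ ih =>
    rw [antiDiff_add_one, ih, fwdDiff]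
    ring
  | pred k _ ih =>
    have h := antiDiff_add_one (fwdDiff 1 w) (k - 1)
    rw [sub_add_cancel, ih, fwdDiff, sub_add_cancel] at h
    linarith

theorem antiDiff_antiDiff_fwdDiff_fwdDiff (w : ℤ → ℝ) (k : ℤ) :
    antiDiff (antiDiff (fwdDiff 1 (fwdDiff 1 w))) k = w k - w 1 - (k - 1) * fwdDiff 1 w 1 := by
  have h_detrend : (fun k ↦ fwdDiff 1 w k - fwdDiff 1 w 1) =
      fwdDiff 1 fun k : ℤ ↦ w k - k * fwdDiff 1 w 1 := by
    ext k
    simp only [fwdDiff]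
    push_cast
    ring
  rw [antiDiff_fwdDiff, h_detrend, antiDiff_fwdDiff]
  push_cast
  ring

variable {lam : ℝ} {J : ℤ} {w : ℤ → ℝ}

theorem mul_kappa_fwdDiff_fwdDiff (hlam : 0 < lam)
    (hw : fwdDiff 1 w 1 ∈ AddSubgroup.zmultiples (2 * lam))
    (hwJ : |w (J + 1) - w 1| < J * lam) :
    2 * lam * kappa J lam (fwdDiff 1 (fwdDiff 1 w)) = fwdDiff 1 w 1 := by
  obtain ⟨c, hc⟩ := AddSubgroup.mem_zmultiples_iff.1 hw
  have hJ : 0 < (J : ℝ) := pos_of_mul_pos_left ((abs_nonneg _).trans_lt hwJ) hlam.le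
  suffices kappa J lam (fwdDiff 1 (fwdDiff 1 w)) = c by
    rw [this, ← hc, zsmul_eq_mul, mul_comm]
  have h_drift : |(w (J + 1) - w 1) / (2 * J * lam)| < 1 / 2 := by
    rw [abs_div, abs_of_pos (by positivity : 0 < 2 * J * lam), div_lt_iff₀ (by positivity)]
    linarith
  have h_arg : (antiDiff (antiDiff (fwdDiff 1 (fwdDiff 1 w))) 1 -
      antiDiff (antiDiff (fwdDiff 1 (fwdDiff 1 w))) (J + 1)) / (2 * J * lam) =
        c - (w (J + 1) - w 1) / (2 * J * lam) := by
    simp only [antiDiff_antiDiff_fwdDiff_fwdDiff, ← hc, zsmul_eq_mul]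
    push_cast
    field_simp
    ring
  rw [kappa, h_arg, Int.floor_eq_iff]
  constructor <;> linarith [abs_lt.1 h_drift]

theorem mul_round_div_of_mem_zmultiples (hlam : lam ≠ 0) {x : ℝ}
    (hx : x ∈ AddSubgroup.zmultiples (2 * lam)) : 2 * lam * round (x / lam / 2) = x := by
  obtain ⟨c, rfl⟩ := AddSubgroup.mem_zmultiples_iff.1 hx
  rw [show c • (2 * lam) / lam / 2 = c by rw [zsmul_eq_mul]; field_simp, round_intCast,
    zsmul_eq_mul, mul_comm]

theorem loopStep_fwdDiff_fwdDiff (hlam : 0 < lam)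
    (hw : ∀ k, fwdDiff 1 w k ∈ AddSubgroup.zmultiples (2 * lam))
    (hwJ : |w (J + 1) - w 1| < J * lam) :
    loopStep J lam (fwdDiff 1 (fwdDiff 1 w)) = fwdDiff 1 w := by
  ext k
  rw [loopStep, mul_kappa_fwdDiff_fwdDiff hlam (hw 1) hwJ, antiDiff_fwdDiff,
    mul_round_div_of_mem_zmultiples hlam.ne' (sub_mem (hw k) (hw 1)), sub_add_cancel]

theorem loopStep_iterate_fwdDiff_iterate (hlam : 0 < lam)
    (hw : ∀ k, w k ∈ AddSubgroup.zmultiples (2 * lam)) {n : ℕ}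
    (hwJ : ∀ j < n, |(fwdDiff (1 : ℤ))^[j] w (J + 1) - (fwdDiff (1 : ℤ))^[j] w 1| < J * lam) :
    (loopStep J lam)^[n] ((fwdDiff (1 : ℤ))^[n + 1] w) = fwdDiff 1 w := by
  induction n with
  | zero => rfl
  | succ n ih =>
    have h_step : loopStep J lam ((fwdDiff (1 : ℤ))^[n + 2] w) = (fwdDiff (1 : ℤ))^[n + 1] w := by
      simp only [Function.iterate_succ_apply']
      refine loopStep_fwdDiff_fwdDiff hlam (fun k ↦ ?_) (hwJ n n.lt_succ_self)
      simpa only [Function.iterate_succ_apply'] using fwdDiff_iter_mem _ hw 1 (n + 1) k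
    rw [Function.iterate_succ_apply, h_step]
    exact ih fun j hj ↦ hwJ j (hj.trans n.lt_succ_self)

theorem initialSeq_eq_fwdDiff_iterate {N : ℕ} {y : ℤ → ℝ}
    (hw : ∀ k, w k ∈ AddSubgroup.zmultiples (2 * lam))
    (hyw : ∀ k, |(fwdDiff (1 : ℤ))^[N] (y + w) k| < lam) :
    initialSeq N lam y = (fwdDiff (1 : ℤ))^[N] w := by
  ext k
  have h_y : (fwdDiff (1 : ℤ))^[N] y k =
      (fwdDiff (1 : ℤ))^[N] (y + w) k - (fwdDiff (1 : ℤ))^[N] w k := by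
    simp [fwdDiff_iter_add]
  rw [initialSeq, h_y, modFold_sub_of_mem_zmultiples (hyw k) (fwdDiff_iter_mem _ hw 1 N k),
    sub_sub_cancel]

theorem lt_blockLength_mul (hlam : 0 < lam) {βg : ℝ} (hβ : 0 ≤ βg) {N j : ℕ} (hj : j + 2 ≤ N) :
    2 * (βg + 2 ^ j * lam) < blockLength N lam βg * lam := by
  have h_pow : (2 : ℝ) ^ j ≤ (2 : ℝ) ^ ((N : ℤ) - 2) := by
    rw [← zpow_natCast]
    exact zpow_le_zpow_right₀ one_le_two (by lia)
  calc 2 * (βg + 2 ^ j * lam) < 4 * (βg + 2 ^ j * lam) := by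
        linarith [show 0 < βg + 2 ^ j * lam by positivity]
    _ = 4 * (βg / lam + 2 ^ j) * lam := by field_simp
    _ ≤ 4 * (βg / lam + (2 : ℝ) ^ ((N : ℤ) - 2)) * lam := by gcongr
    _ ≤ blockLength N lam βg * lam := by
        gcongr
        exact Int.le_ceil _

theorem exists_recover_eq_add (hlam : 0 < lam) {βg : ℝ} (hβ : 0 ≤ βg) {N : ℕ} (hN : 1 ≤ N)
    {y : ℤ → ℝ} (hw : ∀ k, w k ∈ AddSubgroup.zmultiples (2 * lam))
    (hyw : ∀ k, |(fwdDiff (1 : ℤ))^[N] (y + w) k| < lam)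
    (hw_growth : ∀ j k, |(fwdDiff (1 : ℤ))^[j] w k| ≤ βg + 2 ^ j * lam) (m : ℤ) :
    ∃ m' : ℤ, ∀ k, recover N lam βg m y k = y k + w k + 2 * m' * lam := by
  obtain ⟨n, rfl⟩ := Nat.exists_eq_add_of_le' hN
  obtain ⟨c, hc⟩ := AddSubgroup.mem_zmultiples_iff.1 (hw 1)
  have h_loop : (loopStep (blockLength (n + 1) lam βg) lam)^[n] (initialSeq (n + 1) lam y) =
      fwdDiff 1 w := by
    rw [initialSeq_eq_fwdDiff_iterate hw hyw]
    refine loopStep_iterate_fwdDiff_iterate hlam hw fun j hj ↦ ?_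
    calc _ ≤ (βg + 2 ^ j * lam) + (βg + 2 ^ j * lam) :=
          (abs_sub _ _).trans (add_le_add (hw_growth j _) (hw_growth j _))
      _ = 2 * (βg + 2 ^ j * lam) := by ring
      _ < _ := lt_blockLength_mul hlam hβ (by lia)
  refine ⟨m - c, fun k ↦ ?_⟩
  rw [recover, Nat.add_sub_cancel, h_loop, antiDiff_fwdDiff, ← hc, zsmul_eq_mul]
  push_cast
  ring

theorem abs_fwdDiff_iter_sub_modFold_le (hlam : 0 < lam) {γ : ℤ → ℝ} {x M : ℝ} (hx : 0 ≤ x)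
    (hγ : ∀ n k, |(fwdDiff (1 : ℤ))^[n] γ k| ≤ x ^ n * M) {N : ℕ} (hN : x ^ N * M < lam)
    (n : ℕ) (k : ℤ) :
    |(fwdDiff (1 : ℤ))^[n] (γ - modFold lam ∘ γ) k| ≤ M + 2 ^ n * lam := by
  have hM (k : ℤ) : |γ k| ≤ M := by simpa using hγ 0 k
  have hM_nonneg : 0 ≤ M := (abs_nonneg _).trans (hM 0)
  rcases le_total x 1 with hx1 | hx1
  · rw [fwdDiff_iter_sub, Pi.sub_apply]
    refine (abs_sub _ _).trans (add_le_add ((hγ n k).trans ?_) ?_)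
    · exact mul_le_of_le_one_left hM_nonneg (pow_le_one₀ hx hx1)
    · exact norm_fwdDiff_iter_le (f := modFold lam ∘ γ) (fun k ↦ abs_modFold_le hlam (γ k)) 1 n k
  · -- The bounds on the differences of `γ` need not decrease here, but no sample is folded.
    have hM_lt : M < lam := (le_mul_of_one_le_left hM_nonneg (one_le_pow₀ hx1)).trans_lt hN
    have h_unfolded : γ - modFold lam ∘ γ = 0 := by
      ext k
      simp [modFold_eq_self ((hM k).trans_lt hM_lt)]
    rw [h_unfolded]
    refine (norm_fwdDiff_iter_le (f := (0 : ℤ → ℝ)) (fun _ ↦ ?_) 1 n k).trans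
      (le_add_of_nonneg_left hM_nonneg)
    simpa using hlam.le

theorem exists_recover_modFold_add_eq (hlam : 0 < lam) {βg x M C : ℝ} {γ η : ℤ → ℝ}
    (hx : 0 ≤ x) (hγ : ∀ n k, |(fwdDiff (1 : ℤ))^[n] γ k| ≤ x ^ n * M) (hMβ : M ≤ βg)
    (hη : ∀ k, |η k| ≤ C) {N : ℕ} (hN : 1 ≤ N) (hNC : x ^ N * M + 2 ^ N * C < lam) (m : ℤ) :
    ∃ m' : ℤ, ∀ k,
      recover N lam βg m (modFold lam ∘ γ + η) k = γ k + η k + 2 * m' * lam := by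
  have hM_nonneg : 0 ≤ M := by simpa using (abs_nonneg _).trans (hγ 0 0)
  have hC_nonneg : 0 ≤ C := (abs_nonneg _).trans (hη 0)
  have h_sum : modFold lam ∘ γ + η + (γ - modFold lam ∘ γ) = γ + η := by abel
  have h_mem (k : ℤ) : (γ - modFold lam ∘ γ) k ∈ AddSubgroup.zmultiples (2 * lam) :=
    ((modFold_eq_iff hlam).1 rfl).2
  have h_small (k : ℤ) : |(fwdDiff (1 : ℤ))^[N] (γ + η) k| < lam := by
    rw [fwdDiff_iter_add]
    exact (abs_add_le _ _).trans_lt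
      ((add_le_add (hγ N k) (norm_fwdDiff_iter_le (f := η) hη 1 N k)).trans_lt hNC)
  have h_growth (n : ℕ) (k : ℤ) :
      |(fwdDiff (1 : ℤ))^[n] (γ - modFold lam ∘ γ) k| ≤ βg + 2 ^ n * lam :=
    (abs_fwdDiff_iter_sub_modFold_le hlam hx hγ
      ((le_add_of_nonneg_right (by positivity)).trans_lt hNC) n k).trans (by gcongr)
  obtain ⟨m', hm'⟩ := exists_recover_eq_add hlam (hM_nonneg.trans hMβ) hN h_mem
    (by rwa [h_sum]) h_growth m
  refine ⟨m', fun k ↦ ?_⟩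
  rw [hm', ← Pi.add_apply (modFold lam ∘ γ + η), h_sum, Pi.add_apply]

end Algorithm

section Signal

theorem IsPaleyWiener.isBandlimited {B : ℝ} {g : ℝ → ℝ} (hg : IsPaleyWiener (2 * π * B) g) :
    IsBandlimited B fun t ↦ (g t : ℂ) := by
  obtain ⟨hg_cont, hg2, h_supp⟩ := hg
  refine isBandlimited_of_fourier_toLp_ae_eq_zero (Complex.continuous_ofReal.comp hg_cont) hg2 ?_
  filter_upwards [h_supp] with ξ hξ hBξ
  apply hξ
  rw [abs_mul, abs_of_pos Real.two_pi_pos]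
  exact mul_lt_mul_of_pos_left hBξ Real.two_pi_pos

theorem IsPaleyWiener.abs_fwdDiff_iter_samples_le {B M : ℝ} {g : ℝ → ℝ} (hB : 0 < B)
    (hg : IsPaleyWiener (2 * π * B) g) (hM : ∀ t, |g t| ≤ M) (T : ℝ) (n : ℕ) (k : ℤ) :
    |(fwdDiff (1 : ℤ))^[n] (samples g T) k| ≤ (2 * π * B * |T|) ^ n * M := by
  let ψ : ℤ →+ ℝ := zmultiplesHom ℝ T
  have h_samples : samples g T = g ∘ ψ := by
    ext k
    simp [samples, ψ]
  have h_complex : (fwdDiff T)^[n] (fun t ↦ (g t : ℂ)) (ψ k) = ((fwdDiff T)^[n] g (ψ k) : ℝ) :=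
    congrFun (fwdDiff_iter_addMonoidHom_comp (Complex.ofRealHom : ℝ →+ ℂ) T g n) (ψ k)
  have h := hg.isBandlimited.norm_fwdDiff_iter_le hB (M := M) (by simpa using hM) T n (ψ k)
  rw [h_complex, Complex.norm_real, Real.norm_eq_abs] at h
  rw [h_samples, fwdDiff_iter_comp_addMonoidHom]
  simpa [ψ] using h

theorem abs_le_supNorm {α : Type*} {f : α → ℝ} {C : ℝ} (hf : ∀ t, |f t| ≤ C) (t : α) :
    |f t| ≤ supNorm f :=
  le_ciSup (f := fun t ↦ |f t|) ⟨C, forall_mem_range.2 hf⟩ t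

theorem abs_quantError_le {lam : ℝ} (hlam : 0 < lam) (b : ℕ) (g : ℝ → ℝ) (T : ℝ) (k : ℤ) :
    |quantError lam b g T k| ≤ lam * (2 : ℝ) ^ (-(b : ℤ)) :=
  abs_quantize_sub_le hlam b _

theorem quantizedSamples_eq_add (lam : ℝ) (b : ℕ) (g : ℝ → ℝ) (T : ℝ) :
    quantizedSamples lam b g T = modFold lam ∘ samples g T + quantError lam b g T := by
  ext k
  exact (add_sub_cancel _ _).symm

theorem pow_mul_lt_of_pi_mul_rpow_lt_overFactor {lam B fs d M : ℝ} (hlam : 0 < lam) (hB : 0 < B)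
    (hfs : 0 < fs) (hd : 0 < d) (hM : 0 ≤ M) {N : ℕ} (hN : N ≠ 0)
    (h_rate : π * (M / lam / d) ^ (1 / (N : ℝ)) < overFactor fs B) :
    (2 * π * B * |1 / fs|) ^ N * M < lam * d := by
  have hx : 0 < 2 * π * B * |1 / fs| := by positivity
  have h_overFactor : overFactor fs B = π * (2 * π * B * |1 / fs|)⁻¹ := by
    rw [overFactor, abs_of_pos (by positivity)]
    field_simp
  rw [h_overFactor, mul_lt_mul_iff_right₀ Real.pi_pos, one_div,
    Real.rpow_inv_lt_iff_of_pos (by positivity) (by positivity) (by positivity),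
    Real.rpow_natCast, inv_pow, div_div, div_lt_iff₀ (by positivity)] at h_rate
  rwa [← lt_inv_mul_iff₀ (by positivity)]

end Signal

end ModuloADC

theorem mainTheorem4 (lam B fs βg : ℝ) (b : ℕ) (g : ℝ → ℝ)
    (hlam : 0 < lam) (hB : 0 < B) (hfs : 0 < fs)
    (hg : ModuloADC.IsPaleyWiener (2 * Real.pi * B) g)
    (hβg : ∀ t, |g t| ≤ βg) :
    (BddAbove (Set.range fun k : ℤ => |ModuloADC.quantError lam b g (1 / fs) k|) ∧
      ModuloADC.noiseLevel lam (ModuloADC.quantError lam b g (1 / fs)) ≤ (2 : ℝ) ^ (-(b : ℤ))) ∧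
    ∀ N : ℕ, 1 ≤ N → N < b →
      Real.pi * (ModuloADC.ampFactor lam g / (1 - (2 : ℝ) ^ ((N : ℤ) - (b : ℤ)))) ^ (1 / (N : ℝ))
        < ModuloADC.overFactor fs B →
      ∀ m : ℤ, ∃ m' : ℤ, ∀ k : ℤ,
        ModuloADC.recover N lam βg m (ModuloADC.quantizedSamples lam b g (1 / fs)) k =
          ModuloADC.samples g (1 / fs) k + ModuloADC.quantError lam b g (1 / fs) k
            + 2 * m' * lam := by
  have h_noise := ModuloADC.abs_quantError_le hlam b g (1 / fs)
  refine ⟨⟨⟨_, Set.forall_mem_range.2 h_noise⟩, ?_⟩, fun N hN hNb h_rate m ↦ ?_⟩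
  · rw [ModuloADC.noiseLevel, div_le_iff₀' hlam]
    exact ciSup_le h_noise
  have h_sup := ModuloADC.abs_le_supNorm hβg
  have h_gap : 0 < 1 - (2 : ℝ) ^ ((N : ℤ) - b) :=
    sub_pos.2 (zpow_lt_one_of_neg₀ one_lt_two (by lia))
  have h_signal := ModuloADC.pow_mul_lt_of_pi_mul_rpow_lt_overFactor hlam hB hfs h_gap
    ((abs_nonneg _).trans (h_sup 0)) (Nat.one_le_iff_ne_zero.1 hN) h_rate
  have h_noise_diff : (2 : ℝ) ^ N * (lam * 2 ^ (-(b : ℤ))) = lam * 2 ^ ((N : ℤ) - b) := by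
    rw [sub_eq_add_neg, zpow_add₀ two_ne_zero, zpow_natCast]
    ring
  rw [ModuloADC.quantizedSamples_eq_add]
  exact ModuloADC.exists_recover_modFold_add_eq hlam (by positivity)
    (hg.abs_fwdDiff_iter_samples_le hB h_sup _) (ciSup_le hβg) h_noise hN (by linarith) m
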